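/- **Setting.** Let $V=\{1,\dots,n\}$, $n\ge 1$, be a set of individuals with influence weights $W=[w_{ij}]\in\mathbb R^{n\times n}$, $w_{ij}\ge 0$, $w_{ii}=0$, and innate opinions $s_i\in[0,1]$; put $\overline s=\max_i s_i$ and $\underline s=\min_i s_i$. Let $\beta,\gamma\in\mathbb R$ satisfy $\beta\ge\gamma\ge 0$, $\gamma\neq 0$, and $$1-\max\{\|W\|_\infty,\|W\|_1\}\ \ge\ \max\{2\beta,4\gamma\},$$ where $\|W\|_\infty$ and $\|W\|_1$ are the maximal absolute row and column sums, and assume that $W$ has a (componentwise) positive eigenvector. Let $\lambda$ be the largest modulus of an eigenvalue of $W$ and let $c\ge 0$, $c\ne 0$, satisfy $W^\top c=\lambda c$. Two information sources hold opinions $g\in[0,\underline s]$ and $h\in[\overline s,1]$. Individual opinions evolve by $$x_i(k+1)=\alpha_i(x_i(k))\,s_i+\sum_j w_{ij}x_j(k)+\overline w(x_i(k))\,h+\underline w(x_i(k))\,g,$$ with $\overline w(t)=\beta-\gamma|t-h|$, $\underline w(t)=\beta-\gamma|t-g|$ and $\alpha_i(t)=1-\sum_j w_{ij}-\overline w(t)-\underline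 w(t)$. With $E=I-W+(g-h)\gamma I$ and $D=\mathrm{diag}\big(\sum_j w_{1j},\dots,\sum_j w_{nj}\big)$ let $$x^*(g,h)=E^{-1}\big(I-D-2\beta I+(h-g)\gamma I\big)s+E^{-1}\big((h+g)\beta\mathbf 1+(g^2-h^2)\gamma\mathbf 1\big).$$ Consider the zero-sum game with cost $f(g,h)=c^\top x^*(g,h)$, in which $g\in[0,\underline s]$ is chosen to minimize $f$ and $h\in[\overline s,1]$ to maximize $f$. A (pure) Nash equilibrium is a pair $(g^*,h^*)\in[0,\underline s]\times[\overline s,1]$ with $f(g^*,h)\le f(g^*,h^*)\le f(g,h^*)$ for all $g\in[0,\underline s]$, $h\in[\overline s,1]$. **Auxiliary functions.** Let $\widehat c_i=c_i/\sum_j c_j$, $\widehat s=\sum_i\widehat c_i s_i$, $\chi=\sum_i\widehat c_i\sum_j s_i w_{ij}$, and $$a_1=1-\lambda+\gamma g,\qquad b_1=(1-2\beta-g\gamma)\widehat s-\chi+g\beta+g^2\gamma,$$ $$a_2=1-\lambda-h\gamma,\qquad b_2=(1-2\beta+h\gamma)\widehat s+h\beta-h^2\gamma-\chi,$$ $$q(g,h)=(\beta+\gamma\widehat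 s-2\gamma h)a_1+b_1\gamma+\gamma^2h^2,\qquad m(g,h)=(\beta-\gamma\widehat s+2\gamma g)a_2+g^2\gamma^2-b_2\gamma,$$ $$r(g)=-\frac{\sqrt{(1-\lambda)(1-\lambda-\beta+2g\gamma)-(2-\lambda-2\beta)\gamma\widehat s-2g\beta\gamma+\gamma\chi}}{\gamma}+\frac{1-\lambda}{\gamma}+g,$$ $$w(h)=\frac{\sqrt{(1-\lambda)(1-\lambda-2h\gamma-\beta)+(2-\lambda-2\beta)\gamma\widehat s+2h\beta\gamma-\chi\gamma}}{\gamma}-\frac{1-\lambda}{\gamma}+h.$$ **Theorem 3.** For all $g\in[0,\underline s]$, $h\in[\overline s,1]$ and every $x(0)\in[0,1]^n$ the opinions $x(k)$ converge to $x^*(g,h)$. The game has exactly one Nash equilibrium $(g^*,h^*)$, and it is the following. - If $m(0,1)\ge 0$, then $(g^*,h^*)=(0,1)$ if $q(0,1)\ge 0$; $(g^*,h^*)=(0,\overline s)$ if $q(0,\overline s)\le 0$; and $(g^*,h^*)=(0,r(0))$ otherwise. - If $m(\underline s,1)\le 0$, then $(g^*,h^*)=(\underline s,1)$. - Otherwise,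 that is, if $m(0,1)<0<m(\underline s,1)$, $(g^*,h^*)=(w(1),1)$. In particular $g^*=0$ or $h^*=1$: at most one source moves toward the center. -/

import Mathlib

open Filter Topology Matrix

/-- Data of the two-source opinion game on a finite set `V` of individuals: influence weights `W`,
innate opinions `s`, bias parameters `β`, `γ`, and the centrality vector `c`. There is an edge
`(i, j)` of the influence digraph exactly when `W i j > 0`. -/
structure OpinionGame (V : Type*) where
  W : Matrix V V ℝ
  s : V → ℝ
  β : ℝ
  γ : ℝ
  c : V → ℝ

namespace OpinionGame

noncomputable section

variable {V : Type*} [Fintype V] [DecidableEq V]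

/-- `‖W‖_∞`, the largest absolute row sum. -/
def rowNorm (N : OpinionGame V) : ℝ := ⨆ i, ∑ j, |N.W i j|

/-- `‖W‖_1`, the largest absolute column sum. -/
def colNorm (N : OpinionGame V) : ℝ := ⨆ j, ∑ i, |N.W i j|

/-- `λ`, the largest modulus of a complex eigenvalue of `W`. -/
def lam (N : OpinionGame V) : ℝ :=
  (spectralRadius ℂ (N.W.map (fun a : ℝ => (a : ℂ)))).toReal

/-- The largest innate opinion. -/
def sMax (N : OpinionGame V) : ℝ := ⨆ i, N.s i

/-- The smallest innate opinion. -/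
def sMin (N : OpinionGame V) : ℝ := ⨅ i, N.s i

/-- Standing assumptions on the data. -/
structure Admissible (N : OpinionGame V) : Prop where
  weight_nonneg : ∀ i j, 0 ≤ N.W i j
  no_loops : ∀ i, N.W i i = 0
  innate_nonneg : ∀ i, 0 ≤ N.s i
  innate_le_one : ∀ i, N.s i ≤ 1
  gamma_nonneg : 0 ≤ N.γ
  gamma_le_beta : N.γ ≤ N.β
  norm_bound : max (2 * N.β) (4 * N.γ) ≤ 1 - max N.rowNorm N.colNorm
  pos_eigenvector : ∃ v : V → ℝ, (∀ i, 0 < v i) ∧ ∃ μ : ℝ, N.W *ᵥ v = μ • v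
  /- `c` is a Perron eigenvector of the transpose of `W`. -/
  c_nonneg : ∀ i, 0 ≤ N.c i
  c_ne_zero : N.c ≠ 0
  c_eigenvector : N.Wᵀ *ᵥ N.c = N.lam • N.c

/-! ### Opinion dynamics -/

/-- State-dependent influence weight of a source with opinion `y` on an individual with opinion
`t`. -/
def sourceWeight (N : OpinionGame V) (y t : ℝ) : ℝ := N.β - N.γ * |t - y|

/-- Resistance of individual `i` with opinion `t`: all weights at `i` add up to one. -/
def resistance (N : OpinionGame V) (g h : ℝ) (i : V) (t : ℝ) : ℝ :=
  1 - ∑ j, N.W i j - N.sourceWeight h t - N.sourceWeight g t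

/-- One step of the opinion dynamics when the sources hold opinions `g` and `h`. -/
def step (N : OpinionGame V) (g h : ℝ) (x : V → ℝ) : V → ℝ := fun i =>
  N.resistance g h i (x i) * N.s i + ∑ j, N.W i j * x j
    + N.sourceWeight h (x i) * h + N.sourceWeight g (x i) * g

/-- The matrix `E = I - W + (g - h) γ I`. -/
def matE (N : OpinionGame V) (g h : ℝ) : Matrix V V ℝ :=
  1 - N.W + ((g - h) * N.γ) • (1 : Matrix V V ℝ)

/-- The diagonal matrix of the row sums of `W`. -/
def matD (N : OpinionGame V) : Matrix V V ℝ := Matrix.diagonal fun i => ∑ j, N.W i j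

/-- The steady-state opinions `x*(g, h)`. -/
def steadyState (N : OpinionGame V) (g h : ℝ) : V → ℝ :=
  (N.matE g h)⁻¹ *ᵥ
      ((1 - N.matD - (2 * N.β) • (1 : Matrix V V ℝ) + ((h - g) * N.γ) • (1 : Matrix V V ℝ)) *ᵥ N.s)
    + (N.matE g h)⁻¹ *ᵥ (fun _ : V => (h + g) * N.β + (g ^ 2 - h ^ 2) * N.γ)

/-! ### The zero-sum game -/

/-- The cost `f(g, h) = cᵀ x*(g, h)`. -/
def cost (N : OpinionGame V) (g h : ℝ) : ℝ := ∑ i, N.c i * N.steadyState g h i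

/-- `(g, h)` is a (pure) Nash equilibrium: `g ∈ [0, sMin]` minimizes `f(·, h)` over `[0, sMin]`, and
`h ∈ [sMax, 1]` maximizes `f(g, ·)` over `[sMax, 1]`. -/
def IsNash (N : OpinionGame V) (g h : ℝ) : Prop :=
  g ∈ Set.Icc 0 N.sMin ∧ h ∈ Set.Icc N.sMax 1 ∧
    (∀ g' ∈ Set.Icc 0 N.sMin, N.cost g h ≤ N.cost g' h) ∧
    (∀ h' ∈ Set.Icc N.sMax 1, N.cost g h' ≤ N.cost g h)

/-- `(g₀, h₀)` is the Nash equilibrium: it is one, and there is no other. -/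
def IsTheNash (N : OpinionGame V) (g₀ h₀ : ℝ) : Prop :=
  ∀ g h : ℝ, N.IsNash g h ↔ g = g₀ ∧ h = h₀

/-! ### The auxiliary quantities and functions -/

/-- Normalized centrality. -/
def cHat (N : OpinionGame V) (i : V) : ℝ := N.c i / ∑ j, N.c j

/-- Centrality-weighted average innate opinion. -/
def sHat (N : OpinionGame V) : ℝ := ∑ i, N.cHat i * N.s i

/-- Centrality-weighted average of innate opinions scaled by the incoming social weight. -/
def chi (N : OpinionGame V) : ℝ := ∑ i, N.cHat i * ∑ j, N.s i * N.W i j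

def a₁ (N : OpinionGame V) (g : ℝ) : ℝ := 1 - N.lam + N.γ * g

def b₁ (N : OpinionGame V) (g : ℝ) : ℝ :=
  (1 - 2 * N.β - g * N.γ) * N.sHat - N.chi + g * N.β + g ^ 2 * N.γ

def a₂ (N : OpinionGame V) (h : ℝ) : ℝ := 1 - N.lam - h * N.γ

def b₂ (N : OpinionGame V) (h : ℝ) : ℝ :=
  (1 - 2 * N.β + h * N.γ) * N.sHat + h * N.β - h ^ 2 * N.γ - N.chi

def q (N : OpinionGame V) (g h : ℝ) : ℝ :=
  (N.β + N.γ * N.sHat - 2 * N.γ * h) * N.a₁ g + N.b₁ g * N.γ + N.γ ^ 2 * h ^ 2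

def m (N : OpinionGame V) (g h : ℝ) : ℝ :=
  (N.β - N.γ * N.sHat + 2 * N.γ * g) * N.a₂ h + g ^ 2 * N.γ ^ 2 - N.b₂ h * N.γ

def r (N : OpinionGame V) (g : ℝ) : ℝ :=
  -(Real.sqrt ((1 - N.lam) * (1 - N.lam - N.β + 2 * g * N.γ)
      - (2 - N.lam - 2 * N.β) * N.γ * N.sHat - 2 * g * N.β * N.γ + N.γ * N.chi) / N.γ)
    + (1 - N.lam) / N.γ + g

def w (N : OpinionGame V) (h : ℝ) : ℝ :=
  Real.sqrt ((1 - N.lam) * (1 - N.lam - 2 * h * N.γ - N.β)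
      + (2 - N.lam - 2 * N.β) * N.γ * N.sHat + 2 * h * N.β * N.γ - N.chi * N.γ) / N.γ
    - (1 - N.lam) / N.γ + h

end

end OpinionGame

namespace OpinionGame

section

variable {V : Type*} [Fintype V]

/-! The step map is a contraction, and its fixed point lies in `[g, h]`, where the absolute values
open up and the fixed-point equation becomes linear; this gives convergence to the steady state.
Since `c` is a left eigenvector of `W`, it is one of `matE` too, so the cost collapses to the scalar
ratio `costNum / costDen` (`Admissible.cost_eq`), quadratic over affine in each variable. Up to a
positive factor, `q` and `m` are its partial derivatives in `h` and `g`, and the exact expansions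
`cost_sub_cost_right` and `cost_sub_cost_left` make any first-order point the strict best response.
The players are coupled through `q + m = 2 * costDen * (β - γ * (h - g)) ≥ 0`. If the maximizer
leaves `1`, then `q g 1 < 0`, so `m g 1 > 0`; as `m` decreases in `h`, the minimizer must sit at
`0`. The signs of `m` at the endpoints then select the case, and `r`, `w` are the roots of `q 0` and
`m · 1`. -/

lemma sum_weight_le_rowNorm (N : OpinionGame V) (i : V) : ∑ j, N.W i j ≤ N.rowNorm :=
  (Finset.sum_le_sum fun j _ => le_abs_self (N.W i j)).trans
    (le_ciSup (f := fun i => ∑ j, |N.W i j|) (Set.finite_range _).bddAbove i)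

lemma sMin_le (N : OpinionGame V) (i : V) : N.sMin ≤ N.s i :=
  ciInf_le (Set.finite_range _).bddBelow i

lemma le_sMax (N : OpinionGame V) (i : V) : N.s i ≤ N.sMax :=
  le_ciSup (f := N.s) (Set.finite_range _).bddAbove i

lemma step_apply (N : OpinionGame V) (g h : ℝ) (x : V → ℝ) (i : V) :
    N.step g h x i = (1 - ∑ j, N.W i j) * N.s i + ∑ j, N.W i j * x j
      + N.sourceWeight h (x i) * (h - N.s i) + N.sourceWeight g (x i) * (g - N.s i) := by
  simp only [step, resistance]
  ring

end

variable {V : Type*} [Fintype V] [DecidableEq V] {N : OpinionGame V} {g h : ℝ}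

/-! ### Bounds from the standing assumptions -/

lemma Admissible.sMax_le_one [Nonempty V] (hN : N.Admissible) : N.sMax ≤ 1 :=
  ciSup_le hN.innate_le_one

lemma Admissible.sMin_nonneg [Nonempty V] (hN : N.Admissible) : 0 ≤ N.sMin :=
  le_ciInf hN.innate_nonneg

lemma Admissible.gamma_pos (hN : N.Admissible) (hγ : N.γ ≠ 0) : 0 < N.γ :=
  lt_of_le_of_ne hN.gamma_nonneg hγ.symm

lemma Admissible.rowNorm_add_gamma_le (hN : N.Admissible) : N.rowNorm + 4 * N.γ ≤ 1 := by
  have h₁ := hN.norm_bound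
  have h₂ := le_max_right (2 * N.β) (4 * N.γ)
  have h₃ := le_max_left N.rowNorm N.colNorm
  linarith

lemma Admissible.rowNorm_add_beta_le (hN : N.Admissible) : N.rowNorm + 2 * N.β ≤ 1 := by
  have h₁ := hN.norm_bound
  have h₂ := le_max_left (2 * N.β) (4 * N.γ)
  have h₃ := le_max_left N.rowNorm N.colNorm
  linarith

lemma Admissible.rowNorm_nonneg [Nonempty V] (hN : N.Admissible) : 0 ≤ N.rowNorm :=
  (Finset.sum_nonneg fun j _ => hN.weight_nonneg (Classical.arbitrary V) j).trans
    (N.sum_weight_le_rowNorm _)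

lemma Admissible.sum_c_pos (hN : N.Admissible) : 0 < ∑ i, N.c i := by
  obtain ⟨i, hi⟩ := Function.ne_iff.mp hN.c_ne_zero
  exact Finset.sum_pos' (fun i _ => hN.c_nonneg i)
    ⟨i, Finset.mem_univ i, lt_of_le_of_ne (hN.c_nonneg i) (Ne.symm hi)⟩

lemma Admissible.sum_c_mul_weight (hN : N.Admissible) (j : V) :
    ∑ i, N.c i * N.W i j = N.lam * N.c j := by
  have := congrFun hN.c_eigenvector j
  simpa [Matrix.mulVec, dotProduct, mul_comm] using this

/-- Summing the eigenvector equation for `c` over all coordinates exhibits `lam` as a `c`-weighted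
mean of row sums. -/
lemma Admissible.lam_le_rowNorm (hN : N.Admissible) : N.lam ≤ N.rowNorm := by
  have h₁ : N.lam * ∑ j, N.c j ≤ N.rowNorm * ∑ j, N.c j := by
    calc N.lam * ∑ j, N.c j = ∑ i, N.c i * ∑ j, N.W i j := by
          simp_rw [Finset.mul_sum, ← hN.sum_c_mul_weight]
          exact Finset.sum_comm
      _ ≤ ∑ i, N.c i * N.rowNorm := Finset.sum_le_sum fun i _ =>
          mul_le_mul_of_nonneg_left (N.sum_weight_le_rowNorm i) (hN.c_nonneg i)
      _ = N.rowNorm * ∑ j, N.c j := by rw [← Finset.sum_mul, mul_comm]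
  exact le_of_mul_le_mul_right h₁ hN.sum_c_pos

/-! ### Dynamics -/

lemma Admissible.abs_sourceWeight_sub_le (hN : N.Admissible) (y t u : ℝ) :
    |N.sourceWeight y t - N.sourceWeight y u| ≤ N.γ * |t - u| := by
  have h₁ : N.sourceWeight y t - N.sourceWeight y u = N.γ * (|u - y| - |t - y|) := by
    simp only [sourceWeight]; ring
  rw [h₁, abs_mul, abs_of_nonneg hN.gamma_nonneg]
  refine mul_le_mul_of_nonneg_left ?_ hN.gamma_nonneg
  calc |(|u - y| - |t - y|)| ≤ |(u - y) - (t - y)| := abs_abs_sub_abs_le_abs_sub _ _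
    _ = |t - u| := by rw [abs_sub_comm t u]; congr 1; ring

/-- As `s i` lies between `g` and `h`, the two sources together contribute `γ * ((h - s i) + (s i -
g)) ≤ γ` to the Lipschitz constant. -/
lemma Admissible.contractingWith_step [Nonempty V] (hN : N.Admissible) (hγ : N.γ ≠ 0)
    (hg : g ∈ Set.Icc 0 N.sMin) (hh : h ∈ Set.Icc N.sMax 1) :
    ContractingWith (N.rowNorm + N.γ).toNNReal (N.step g h) := by
  have hγ' := hN.gamma_pos hγ
  have hK : 0 ≤ N.rowNorm + N.γ := add_nonneg hN.rowNorm_nonneg hγ'.le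
  refine ⟨?_, LipschitzWith.of_dist_le_mul fun x y => ?_⟩
  · rw [Real.toNNReal_lt_one]
    linarith [hN.rowNorm_add_gamma_le]
  rw [Real.coe_toNNReal _ hK, dist_pi_le_iff (mul_nonneg hK dist_nonneg)]
  intro i
  have hdist : ∀ j, |x j - y j| ≤ dist x y := fun j => by
    rw [← Real.dist_eq]; exact dist_le_pi_dist x y j
  have hs₀ := (hg.2.trans (N.sMin_le i))
  have hs₁ := ((N.le_sMax i).trans hh.1)
  have hW : |∑ j, N.W i j * (x j - y j)| ≤ N.rowNorm * dist x y :=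
    calc |∑ j, N.W i j * (x j - y j)| ≤ ∑ j, |N.W i j * (x j - y j)| :=
          Finset.abs_sum_le_sum_abs _ _
      _ ≤ ∑ j, N.W i j * dist x y := Finset.sum_le_sum fun j _ => by
          rw [abs_mul, abs_of_nonneg (hN.weight_nonneg i j)]
          exact mul_le_mul_of_nonneg_left (hdist j) (hN.weight_nonneg i j)
      _ = (∑ j, N.W i j) * dist x y := by rw [Finset.sum_mul]
      _ ≤ N.rowNorm * dist x y :=
          mul_le_mul_of_nonneg_right (N.sum_weight_le_rowNorm i) dist_nonneg
  have hsrc : ∀ z, |(N.sourceWeight z (x i) - N.sourceWeight z (y i)) * (z - N.s i)|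
      ≤ N.γ * dist x y * |z - N.s i| := fun z => by
    rw [abs_mul]
    exact mul_le_mul_of_nonneg_right ((hN.abs_sourceWeight_sub_le z _ _).trans
      (mul_le_mul_of_nonneg_left (hdist i) hγ'.le)) (abs_nonneg _)
  have hsrch := hsrc h
  have hsrcg := hsrc g
  rw [abs_of_nonneg (sub_nonneg.2 hs₁)] at hsrch
  rw [abs_of_nonpos (sub_nonpos.2 hs₀)] at hsrcg
  have hsplit : N.step g h x i - N.step g h y i = ∑ j, N.W i j * (x j - y j)
      + (N.sourceWeight h (x i) - N.sourceWeight h (y i)) * (h - N.s i)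
      + (N.sourceWeight g (x i) - N.sourceWeight g (y i)) * (g - N.s i) := by
    simp only [step_apply, mul_sub, Finset.sum_sub_distrib]
    ring
  rw [Real.dist_eq, hsplit]
  refine (abs_add_three _ _ _).trans ?_
  have hgh : N.γ * dist x y * (h - g) ≤ N.γ * dist x y * 1 :=
    mul_le_mul_of_nonneg_left (by linarith [hg.1, hh.2]) (mul_nonneg hγ'.le dist_nonneg)
  linarith

/-- Each new opinion is a convex combination of `s i`, the neighbours' opinions, `h` and `g`. The
source weights are nonnegative because distances are at most `h - g ≤ 1` and `γ ≤ β`. -/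
lemma Admissible.step_mem_Icc (hN : N.Admissible)
    (hg : g ∈ Set.Icc 0 N.sMin) (hh : h ∈ Set.Icc N.sMax 1) {x : V → ℝ}
    (hx : ∀ i, x i ∈ Set.Icc g h) (i : V) : N.step g h x i ∈ Set.Icc g h := by
  have hγ' := hN.gamma_nonneg
  have hs₀ := (hg.2.trans (N.sMin_le i))
  have hs₁ := ((N.le_sMax i).trans hh.1)
  have hgh : h - g ≤ 1 := by linarith [hg.1, hh.2]
  have hsrc : ∀ t, t ≤ h - g → 0 ≤ N.β - N.γ * t := fun t ht => by
    nlinarith [mul_le_mul_of_nonneg_left (ht.trans hgh) hγ', hN.gamma_le_beta]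
  have hwh : 0 ≤ N.sourceWeight h (x i) := by
    rw [sourceWeight, abs_of_nonpos (by linarith [(hx i).2])]
    exact hsrc _ (by linarith [(hx i).1])
  have hwg : 0 ≤ N.sourceWeight g (x i) := by
    rw [sourceWeight, abs_of_nonneg (by linarith [(hx i).1])]
    exact hsrc _ (by linarith [(hx i).2])
  have hle : ∀ t, N.sourceWeight t (x i) ≤ N.β := fun t => by
    have := mul_nonneg hγ' (abs_nonneg (x i - t))
    simp only [sourceWeight]; linarith
  have hres : 0 ≤ N.resistance g h i (x i) := by
    simp only [resistance]
    linarith [hle h, hle g, N.sum_weight_le_rowNorm i, hN.rowNorm_add_beta_le]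
  have hlow : (∑ j, N.W i j) * g ≤ ∑ j, N.W i j * x j := by
    rw [Finset.sum_mul]
    exact Finset.sum_le_sum fun j _ =>
      mul_le_mul_of_nonneg_left (hx j).1 (hN.weight_nonneg i j)
  have hup : ∑ j, N.W i j * x j ≤ (∑ j, N.W i j) * h := by
    rw [Finset.sum_mul]
    exact Finset.sum_le_sum fun j _ =>
      mul_le_mul_of_nonneg_left (hx j).2 (hN.weight_nonneg i j)
  have hdef : N.resistance g h i (x i) + ∑ j, N.W i j + N.sourceWeight h (x i)
      + N.sourceWeight g (x i) = 1 := by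
    simp only [resistance]; ring
  simp only [step]
  generalize N.resistance g h i (x i) = R at *
  generalize N.sourceWeight h (x i) = P at *
  generalize N.sourceWeight g (x i) = Q at *
  generalize ∑ j, N.W i j = D at *
  generalize ∑ j, N.W i j * x j = S at *
  obtain rfl : R = 1 - D - P - Q := by linarith
  constructor
  · nlinarith [mul_le_mul_of_nonneg_left hs₀ hres,
      mul_le_mul_of_nonneg_left (hs₀.trans hs₁) hwh]
  · nlinarith [mul_le_mul_of_nonneg_left hs₁ hres,
      mul_le_mul_of_nonneg_left (hs₀.trans hs₁) hwg]

/-- The matrix is strictly diagonally dominant by rows. -/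
lemma Admissible.isUnit_det_matE [Nonempty V] (hN : N.Admissible) (hγ : N.γ ≠ 0)
    (hg : g ∈ Set.Icc 0 N.sMin) (hh : h ∈ Set.Icc N.sMax 1) : IsUnit (N.matE g h).det := by
  have hγ' := hN.gamma_pos hγ
  refine isUnit_iff_ne_zero.2 (det_ne_zero_of_sum_row_lt_diag fun i => ?_)
  have hdiag : N.matE g h i i = 1 + (g - h) * N.γ := by
    simp [matE, hN.no_loops]
  have hoff : ∑ j ∈ Finset.univ.erase i, ‖N.matE g h i j‖ = ∑ j, N.W i j := by
    rw [← Finset.add_sum_erase Finset.univ (N.W i) (Finset.mem_univ i), hN.no_loops, zero_add]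
    refine Finset.sum_congr rfl fun j hj => ?_
    have hij : i ≠ j := (Finset.ne_of_mem_erase hj).symm
    simp [matE, Matrix.one_apply_ne hij, abs_of_nonneg (hN.weight_nonneg i j)]
  rw [hoff, hdiag]
  refine lt_of_lt_of_le ?_ (Real.le_norm_self _)
  have : (h - g) * N.γ ≤ 1 * N.γ :=
    mul_le_mul_of_nonneg_right (by linarith [hg.1, hh.2]) hγ'.le
  linarith [N.sum_weight_le_rowNorm i, hN.rowNorm_add_gamma_le]

lemma matE_mulVec_apply (N : OpinionGame V) (g h : ℝ) (x : V → ℝ) (i : V) :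
    (N.matE g h *ᵥ x) i = x i - ∑ j, N.W i j * x j + (g - h) * N.γ * x i := by
  simp [matE, Matrix.add_mulVec, Matrix.sub_mulVec, Matrix.smul_mulVec]
  rfl

/-- The inhomogeneous term of the linear system solved by the steady state. -/
def forcing (N : OpinionGame V) (g h : ℝ) (i : V) : ℝ :=
  (1 - ∑ j, N.W i j - 2 * N.β + (h - g) * N.γ) * N.s i
    + ((h + g) * N.β + (g ^ 2 - h ^ 2) * N.γ)

lemma steadyState_eq (N : OpinionGame V) (g h : ℝ) :
    N.steadyState g h = (N.matE g h)⁻¹ *ᵥ N.forcing g h := by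
  rw [steadyState, ← Matrix.mulVec_add]
  congr 1
  funext i
  simp [forcing, matD, Matrix.add_mulVec, Matrix.sub_mulVec, Matrix.smul_mulVec,
    Matrix.mulVec_diagonal]
  ring

lemma Admissible.eq_steadyState_of_isFixedPt [Nonempty V] (hN : N.Admissible) (hγ : N.γ ≠ 0)
    (hg : g ∈ Set.Icc 0 N.sMin) (hh : h ∈ Set.Icc N.sMax 1) {x : V → ℝ}
    (hx : ∀ i, x i ∈ Set.Icc g h) (hfix : N.step g h x = x) : x = N.steadyState g h := by
  have hE : N.matE g h *ᵥ x = N.forcing g h := by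
    funext i
    have h₁ := congrFun hfix i
    rw [step_apply, sourceWeight, sourceWeight, abs_of_nonpos (by linarith [(hx i).2]),
      abs_of_nonneg (by linarith [(hx i).1])] at h₁
    rw [matE_mulVec_apply, forcing]
    linear_combination -h₁
  rw [steadyState_eq, ← hE, Matrix.mulVec_mulVec,
    Matrix.nonsing_inv_mul _ (hN.isUnit_det_matE hγ hg hh), Matrix.one_mulVec]

theorem Admissible.tendsto_iterate_step [Nonempty V] (hN : N.Admissible) (hγ : N.γ ≠ 0)
    (hg : g ∈ Set.Icc 0 N.sMin) (hh : h ∈ Set.Icc N.sMax 1) (x₀ : V → ℝ) :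
    Tendsto (fun k : ℕ => (N.step g h)^[k] x₀) atTop (𝓝 (N.steadyState g h)) := by
  have hc := hN.contractingWith_step hγ hg hh
  -- The orbit of `s` stays in the closed box `[g, h]`, which locates the fixed point; the
  -- contraction then carries any other start to it.
  have hmem : ∀ k : ℕ, ∀ i, (N.step g h)^[k] N.s i ∈ Set.Icc g h := by
    intro k
    induction k with
    | zero => exact fun i => ⟨hg.2.trans (N.sMin_le i), (N.le_sMax i).trans hh.1⟩
    | succ k ih =>
      rw [Function.iterate_succ_apply']
      exact hN.step_mem_Icc hg hh ih
  have hlim : ∀ i, ContractingWith.fixedPoint (N.step g h) hc i ∈ Set.Icc g h := fun i =>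
    isClosed_Icc.mem_of_tendsto
      (tendsto_pi_nhds.1 (hc.tendsto_iterate_fixedPoint N.s) i)
      (Eventually.of_forall fun k => hmem k i)
  rw [← hN.eq_steadyState_of_isFixedPt hγ hg hh hlim hc.fixedPoint_isFixedPt]
  exact hc.tendsto_iterate_fixedPoint x₀

/-! ### Cost -/

/-- The numerator of the normalized cost. -/
noncomputable def costNum (N : OpinionGame V) (g h : ℝ) : ℝ :=
  (1 - 2 * N.β + (h - g) * N.γ) * N.sHat - N.chi + (h + g) * N.β + (g ^ 2 - h ^ 2) * N.γ

/-- The denominator of the normalized cost. -/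
noncomputable def costDen (N : OpinionGame V) (g h : ℝ) : ℝ := 1 - N.lam + (g - h) * N.γ

lemma Admissible.costDen_pos (hN : N.Admissible) (hγ : N.γ ≠ 0) (hgh : h - g ≤ 1) :
    0 < N.costDen g h := by
  have hγ' := hN.gamma_pos hγ
  have := mul_le_mul_of_nonneg_right hgh hγ'.le
  rw [costDen]
  linarith [hN.lam_le_rowNorm, hN.rowNorm_add_gamma_le]

lemma Admissible.dotProduct_forcing (hN : N.Admissible) :
    N.c ⬝ᵥ N.forcing g h = (∑ i, N.c i) * N.costNum g h := by
  have hC := hN.sum_c_pos.ne'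
  have hs : (∑ i, N.c i) * N.sHat = ∑ i, N.c i * N.s i := by
    rw [sHat, Finset.mul_sum]
    exact Finset.sum_congr rfl fun i _ => by rw [cHat]; field_simp
  have hχ : (∑ i, N.c i) * N.chi = ∑ i, N.c i * (N.s i * ∑ j, N.W i j) := by
    rw [chi, Finset.mul_sum]
    exact Finset.sum_congr rfl fun i _ => by rw [cHat, ← Finset.mul_sum]; field_simp
  have hsum : N.c ⬝ᵥ N.forcing g h
      = (1 - 2 * N.β + (h - g) * N.γ) * ∑ i, N.c i * N.s i
        - ∑ i, N.c i * (N.s i * ∑ j, N.W i j)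
        + ((h + g) * N.β + (g ^ 2 - h ^ 2) * N.γ) * ∑ i, N.c i := by
    rw [Finset.mul_sum (a := 1 - 2 * N.β + (h - g) * N.γ),
      Finset.mul_sum (a := (h + g) * N.β + (g ^ 2 - h ^ 2) * N.γ),
      ← Finset.sum_sub_distrib, ← Finset.sum_add_distrib]
    exact Finset.sum_congr rfl fun i _ => by rw [forcing]; ring
  rw [hsum, ← hs, ← hχ, costNum]
  ring

lemma Admissible.vecMul_matE (hN : N.Admissible) :
    N.c ᵥ* N.matE g h = N.costDen g h • N.c := by
  have hW : N.c ᵥ* N.W = N.lam • N.c := by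
    rw [← Matrix.mulVec_transpose, hN.c_eigenvector]
  rw [matE, Matrix.vecMul_add, Matrix.vecMul_sub, Matrix.vecMul_one, hW, Matrix.vecMul_smul,
    Matrix.vecMul_one, costDen]
  module

lemma Admissible.cost_eq [Nonempty V] (hN : N.Admissible) (hγ : N.γ ≠ 0)
    (hg : g ∈ Set.Icc 0 N.sMin) (hh : h ∈ Set.Icc N.sMax 1) :
    N.cost g h = (∑ i, N.c i) * (N.costNum g h / N.costDen g h) := by
  have hA : N.costDen g h ≠ 0 :=
    (hN.costDen_pos hγ (by linarith [hg.1, hh.2])).ne'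
  have h₁ : N.costDen g h * N.cost g h = (∑ i, N.c i) * N.costNum g h := by
    calc N.costDen g h * N.cost g h = (N.costDen g h • N.c) ⬝ᵥ N.steadyState g h := by
          rw [smul_dotProduct]; rfl
      _ = N.c ⬝ᵥ N.forcing g h := by
          rw [← hN.vecMul_matE, ← Matrix.dotProduct_mulVec, steadyState_eq,
            Matrix.mulVec_mulVec, Matrix.mul_nonsing_inv _ (hN.isUnit_det_matE hγ hg hh),
            Matrix.one_mulVec]
      _ = _ := hN.dotProduct_forcing
  field_simp
  linarith

/-! ### Marginal costs -/

lemma q_eq (N : OpinionGame V) (g h : ℝ) :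
    N.q g h = (N.β + N.γ * N.sHat - 2 * N.γ * h) * N.costDen g h + N.γ * N.costNum g h := by
  simp only [q, a₁, b₁, costDen, costNum]; ring

lemma m_eq (N : OpinionGame V) (g h : ℝ) :
    N.m g h = (N.β - N.γ * N.sHat + 2 * N.γ * g) * N.costDen g h - N.γ * N.costNum g h := by
  simp only [m, a₂, b₂, costDen, costNum]; ring

/-- The `costNum` terms cancel, leaving a sign controlled by `γ ≤ β` alone once `h - g ≤ 1`. -/
lemma q_add_m (N : OpinionGame V) (g h : ℝ) :
    N.q g h + N.m g h = 2 * N.costDen g h * (N.β - N.γ * (h - g)) := by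
  rw [q_eq, m_eq]; ring

lemma Admissible.q_add_m_nonneg (hN : N.Admissible) (hγ : N.γ ≠ 0) (hgh : h - g ≤ 1) :
    0 ≤ N.q g h + N.m g h := by
  rw [q_add_m]
  have := mul_le_mul_of_nonneg_left hgh hN.gamma_nonneg
  exact mul_nonneg (mul_nonneg two_pos.le (hN.costDen_pos hγ hgh).le)
    (by linarith [hN.gamma_le_beta])

lemma Admissible.m_antitone (hN : N.Admissible) {h' : ℝ} (hg : 0 ≤ g) (hhh : h ≤ h')
    (hh : h' ≤ 1) : N.m g h' ≤ N.m g h := by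
  have h₁ : N.m g h - N.m g h' = N.γ * (h' - h) * (2 * N.β + N.γ * (2 * g - h - h')) := by
    simp only [m, a₂, b₂]; ring
  have h₂ : N.γ * (-2) ≤ N.γ * (2 * g - h - h') :=
    mul_le_mul_of_nonneg_left (by linarith) hN.gamma_nonneg
  have h₃ : 0 ≤ N.m g h - N.m g h' := by
    rw [h₁]
    exact mul_nonneg (mul_nonneg hN.gamma_nonneg (sub_nonneg.2 hhh))
      (by linarith [hN.gamma_le_beta])
  linarith

lemma Admissible.m_monotone (hN : N.Admissible) (hγ : N.γ ≠ 0) {g' : ℝ} (hgg : g ≤ g')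
    (hgh : h - g ≤ 1) : N.m g h ≤ N.m g' h := by
  have h₁ : N.m g' h - N.m g h = N.γ * (g' - g) * (N.costDen g h + N.costDen g' h) := by
    simp only [m, a₂, b₂, costDen]; ring
  have h₂ : 0 ≤ N.m g' h - N.m g h := by
    rw [h₁]
    exact mul_nonneg (mul_nonneg hN.gamma_nonneg (sub_nonneg.2 hgg))
      (add_pos (hN.costDen_pos hγ hgh) (hN.costDen_pos hγ (by linarith))).le
  linarith

/-- Clearing denominators leaves a quadratic in `h' - h`, so the expansion is exact; its negative
square term plays the role of strict concavity. -/
lemma Admissible.cost_sub_cost_right [Nonempty V] (hN : N.Admissible) (hγ : N.γ ≠ 0) {h' : ℝ}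
    (hg : g ∈ Set.Icc 0 N.sMin) (hh : h ∈ Set.Icc N.sMax 1) (hh' : h' ∈ Set.Icc N.sMax 1) :
    N.cost g h' - N.cost g h = (∑ i, N.c i) / (N.costDen g h * N.costDen g h')
      * ((h' - h) * N.q g h - N.γ * (h' - h) ^ 2 * N.costDen g h) := by
  have hA := (hN.costDen_pos hγ (g := g) (h := h) (by linarith [hg.1, hh.2])).ne'
  have hA' := (hN.costDen_pos hγ (g := g) (h := h') (by linarith [hg.1, hh'.2])).ne'
  have hnum : N.costNum g h' * N.costDen g h - N.costNum g h * N.costDen g h'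
      = (h' - h) * N.q g h - N.γ * (h' - h) ^ 2 * N.costDen g h := by
    rw [q_eq]; simp only [costNum, costDen]; ring
  rw [hN.cost_eq hγ hg hh, hN.cost_eq hγ hg hh', ← hnum]
  field_simp

lemma Admissible.cost_sub_cost_left [Nonempty V] (hN : N.Admissible) (hγ : N.γ ≠ 0) {g' : ℝ}
    (hg : g ∈ Set.Icc 0 N.sMin) (hg' : g' ∈ Set.Icc 0 N.sMin) (hh : h ∈ Set.Icc N.sMax 1) :
    N.cost g' h - N.cost g h = (∑ i, N.c i) / (N.costDen g h * N.costDen g' h)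
      * ((g' - g) * N.m g h + N.γ * (g' - g) ^ 2 * N.costDen g h) := by
  have hA := (hN.costDen_pos hγ (g := g) (h := h) (by linarith [hg.1, hh.2])).ne'
  have hA' := (hN.costDen_pos hγ (g := g') (h := h) (by linarith [hg'.1, hh.2])).ne'
  have hnum : N.costNum g' h * N.costDen g h - N.costNum g h * N.costDen g' h
      = (g' - g) * N.m g h + N.γ * (g' - g) ^ 2 * N.costDen g h := by
    rw [m_eq]; simp only [costNum, costDen]; ring
  rw [hN.cost_eq hγ hg hh, hN.cost_eq hγ hg' hh, ← hnum]
  field_simp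

/-- A strategy of the maximizer satisfying the first-order condition is the strict best response. -/
lemma Admissible.cost_lt_right [Nonempty V] (hN : N.Admissible) (hγ : N.γ ≠ 0) {h' : ℝ}
    (hg : g ∈ Set.Icc 0 N.sMin) (hh : h ∈ Set.Icc N.sMax 1) (hh' : h' ∈ Set.Icc N.sMax 1)
    (hq : (h' - h) * N.q g h ≤ 0) (hne : h' ≠ h) : N.cost g h' < N.cost g h := by
  have hA := hN.costDen_pos hγ (g := g) (h := h) (by linarith [hg.1, hh.2])
  have hA' := hN.costDen_pos hγ (g := g) (h := h') (by linarith [hg.1, hh'.2])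
  have hsq : 0 < N.γ * (h' - h) ^ 2 * N.costDen g h :=
    mul_pos (mul_pos (hN.gamma_pos hγ) (sq_pos_of_ne_zero (sub_ne_zero.2 hne))) hA
  rw [← sub_neg, hN.cost_sub_cost_right hγ hg hh hh']
  exact mul_neg_of_pos_of_neg (div_pos hN.sum_c_pos (mul_pos hA hA')) (by linarith)

/-- A strategy of the minimizer satisfying the first-order condition is the strict best response. -/
lemma Admissible.cost_lt_left [Nonempty V] (hN : N.Admissible) (hγ : N.γ ≠ 0) {g' : ℝ}
    (hg : g ∈ Set.Icc 0 N.sMin) (hg' : g' ∈ Set.Icc 0 N.sMin) (hh : h ∈ Set.Icc N.sMax 1)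
    (hm : 0 ≤ (g' - g) * N.m g h) (hne : g' ≠ g) : N.cost g h < N.cost g' h := by
  have hA := hN.costDen_pos hγ (g := g) (h := h) (by linarith [hg.1, hh.2])
  have hA' := hN.costDen_pos hγ (g := g') (h := h) (by linarith [hg'.1, hh.2])
  have hsq : 0 < N.γ * (g' - g) ^ 2 * N.costDen g h :=
    mul_pos (mul_pos (hN.gamma_pos hγ) (sq_pos_of_ne_zero (sub_ne_zero.2 hne))) hA
  rw [← sub_pos, hN.cost_sub_cost_left hγ hg hg' hh]
  exact mul_pos (div_pos hN.sum_c_pos (mul_pos hA hA')) (by linarith)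

/-! ### Equilibria -/

lemma IsNash.right_eq [Nonempty V] (hN : N.Admissible) (hγ : N.γ ≠ 0) {h₀ : ℝ}
    (hn : N.IsNash g h) (hh₀ : h₀ ∈ Set.Icc N.sMax 1)
    (hq : ∀ h' ∈ Set.Icc N.sMax 1, (h' - h₀) * N.q g h₀ ≤ 0) : h = h₀ := by
  by_contra hne
  exact absurd (hn.2.2.2 h₀ hh₀)
    (not_le.2 (hN.cost_lt_right hγ hn.1 hh₀ hn.2.1 (hq h hn.2.1) hne))

lemma IsNash.left_eq [Nonempty V] (hN : N.Admissible) (hγ : N.γ ≠ 0) {g₀ : ℝ}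
    (hn : N.IsNash g h) (hg₀ : g₀ ∈ Set.Icc 0 N.sMin)
    (hm : ∀ g' ∈ Set.Icc 0 N.sMin, 0 ≤ (g' - g₀) * N.m g₀ h) : g = g₀ := by
  by_contra hne
  exact absurd (hn.2.2.1 g₀ hg₀)
    (not_le.2 (hN.cost_lt_left hγ hg₀ hn.1 hn.2.1 (hm g hn.1) hne))

lemma Admissible.isNash [Nonempty V] (hN : N.Admissible) (hγ : N.γ ≠ 0)
    (hg : g ∈ Set.Icc 0 N.sMin) (hh : h ∈ Set.Icc N.sMax 1)
    (hm : ∀ g' ∈ Set.Icc 0 N.sMin, 0 ≤ (g' - g) * N.m g h)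
    (hq : ∀ h' ∈ Set.Icc N.sMax 1, (h' - h) * N.q g h ≤ 0) : N.IsNash g h := by
  refine ⟨hg, hh, fun g' hg' => ?_, fun h' hh' => ?_⟩
  · rcases eq_or_ne g' g with rfl | hne
    · exact le_rfl
    · exact (hN.cost_lt_left hγ hg hg' hh (hm g' hg') hne).le
  · rcases eq_or_ne h' h with rfl | hne
    · exact le_rfl
    · exact (hN.cost_lt_right hγ hg hh hh' (hq h' hh') hne).le

/-- From `g > 0`, a move left by a small `t` changes the cost by a positive multiple of `-t * m + γ
* t ^ 2 * costDen`, which is negative for `t < m / (γ * costDen)`. -/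
lemma IsNash.left_eq_zero_of_m_pos [Nonempty V] (hN : N.Admissible) (hγ : N.γ ≠ 0)
    (hn : N.IsNash g h) (hm : 0 < N.m g h) : g = 0 := by
  by_contra hne
  have hg := hn.1
  have hh := hn.2.1
  have hγ' := hN.gamma_pos hγ
  have hg₀ : 0 < g := lt_of_le_of_ne hg.1 (Ne.symm hne)
  have hA := hN.costDen_pos hγ (g := g) (h := h) (by linarith [hg.1, hh.2])
  have hγA := mul_pos hγ' hA
  obtain ⟨t, ht₀, ht⟩ := exists_between (lt_min hg₀ (div_pos hm hγA))
  have htg := (lt_min_iff.1 ht).1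
  have htm : t * (N.γ * N.costDen g h) < N.m g h := (lt_div_iff₀ hγA).1 (lt_min_iff.1 ht).2
  have hg' : g - t ∈ Set.Icc 0 N.sMin := ⟨by linarith, by linarith [hg.2]⟩
  have hA' := hN.costDen_pos hγ (g := g - t) (h := h) (by linarith [hg'.1, hh.2])
  have hle := hn.2.2.1 _ hg'
  rw [← sub_nonneg, hN.cost_sub_cost_left hγ hg hg' hh] at hle
  have h₁ := nonneg_of_mul_nonneg_right hle (div_pos hN.sum_c_pos (mul_pos hA hA'))
  nlinarith [mul_pos ht₀ (sub_pos.2 htm)]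

lemma IsNash.right_eq_one_or_m_pos [Nonempty V] (hN : N.Admissible) (hγ : N.γ ≠ 0)
    (hn : N.IsNash g h) : h = 1 ∨ 0 < N.m g 1 := by
  rcases le_or_gt 0 (N.q g 1) with hq | hq
  · refine Or.inl (hn.right_eq hN hγ ⟨hN.sMax_le_one, le_rfl⟩ fun h' hh' => ?_)
    exact mul_nonpos_of_nonpos_of_nonneg (sub_nonpos.2 hh'.2) hq
  · have := hN.q_add_m_nonneg hγ (g := g) (h := 1) (by linarith [hn.1.1])
    exact Or.inr (by linarith)

theorem IsNash.eq_one_or_left_eq_zero [Nonempty V] (hN : N.Admissible) (hγ : N.γ ≠ 0)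
    (hn : N.IsNash g h) : h = 1 ∨ g = 0 ∧ 0 < N.m 0 1 := by
  refine (hn.right_eq_one_or_m_pos hN hγ).imp_right fun hm => ?_
  have hg := hn.left_eq_zero_of_m_pos hN hγ
    (hm.trans_le (hN.m_antitone hn.1.1 hn.2.1.2 le_rfl))
  exact ⟨hg, hg ▸ hm⟩

/-- If the marginal cost of the minimizer is nonnegative at `(0, 1)`, then the equilibria are
`(0, h₀)` with `h₀` a best response to `0`. -/
theorem Admissible.isTheNash_zero [Nonempty V] (hN : N.Admissible) (hγ : N.γ ≠ 0) {h₀ : ℝ}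
    (hm : 0 ≤ N.m 0 1) (hh₀ : h₀ ∈ Set.Icc N.sMax 1)
    (hq : ∀ h' ∈ Set.Icc N.sMax 1, (h' - h₀) * N.q 0 h₀ ≤ 0) : N.IsTheNash 0 h₀ := by
  have hz : (0 : ℝ) ∈ Set.Icc 0 N.sMin := ⟨le_rfl, hN.sMin_nonneg⟩
  have hfoc : ∀ h ∈ Set.Icc N.sMax 1, ∀ g' ∈ Set.Icc 0 N.sMin, 0 ≤ (g' - 0) * N.m 0 h :=
    fun h hh g' hg' => mul_nonneg (by linarith [hg'.1])
      (hm.trans (hN.m_antitone le_rfl hh.2 le_rfl))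
  intro g h
  constructor
  · intro hn
    obtain rfl := hn.left_eq hN hγ hz (hfoc h hn.2.1)
    exact ⟨rfl, hn.right_eq hN hγ hh₀ hq⟩
  · rintro ⟨rfl, rfl⟩
    exact hN.isNash hγ hz hh₀ (hfoc h hh₀) hq

/-- If the marginal cost of the minimizer is nonpositive at `(0, 1)` and at `(g₀, 1)`, where `g₀` is the
best response to `1`, then `(g₀, 1)` is the equilibrium. -/
theorem Admissible.isTheNash_one [Nonempty V] (hN : N.Admissible) (hγ : N.γ ≠ 0) {g₀ : ℝ}
    (hg₀ : g₀ ∈ Set.Icc 0 N.sMin) (hm₀ : N.m 0 1 ≤ 0) (hmg : N.m g₀ 1 ≤ 0)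
    (hm : ∀ g' ∈ Set.Icc 0 N.sMin, 0 ≤ (g' - g₀) * N.m g₀ 1) : N.IsTheNash g₀ 1 := by
  intro g h
  constructor
  · intro hn
    rcases hn.eq_one_or_left_eq_zero hN hγ with rfl | ⟨-, hpos⟩
    · exact ⟨hn.left_eq hN hγ hg₀ hm, rfl⟩
    · exact absurd hm₀ (not_le.2 hpos)
  · rintro ⟨rfl, rfl⟩
    have hq : 0 ≤ N.q g 1 := by
      linarith [hN.q_add_m_nonneg hγ (g := g) (h := 1) (by linarith [hg₀.1])]
    exact hN.isNash hγ hg₀ ⟨hN.sMax_le_one, le_rfl⟩ hm fun h' hh' =>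
      mul_nonpos_of_nonpos_of_nonneg (sub_nonpos.2 hh'.2) hq

/-! ### Closed forms of the interior best responses -/

lemma Admissible.r_zero_eq (hN : N.Admissible) (hγ : N.γ ≠ 0) (hh : h ≤ 1)
    (hq : N.q 0 h = 0) : N.r 0 = h := by
  have hA := hN.costDen_pos hγ (g := 0) (h := h) (by linarith)
  -- The radicand equals `costDen ^ 2 - q`; at a root of `q`, positivity of `costDen` fixes the
  -- branch of the square root.
  have hdisc : (1 - N.lam) * (1 - N.lam - N.β + 2 * 0 * N.γ)
      - (2 - N.lam - 2 * N.β) * N.γ * N.sHat - 2 * 0 * N.β * N.γ + N.γ * N.chi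
      = N.costDen 0 h ^ 2 := by
    simp only [q, a₁, b₁] at hq
    simp only [costDen]
    linear_combination -hq
  rw [r, hdisc, Real.sqrt_sq hA.le, costDen]
  field_simp
  ring

lemma Admissible.w_one_eq (hN : N.Admissible) (hγ : N.γ ≠ 0) (hg : 0 ≤ g)
    (hm : N.m g 1 = 0) : N.w 1 = g := by
  have hA := hN.costDen_pos hγ (g := g) (h := 1) (by linarith)
  -- Likewise the radicand is `costDen ^ 2 - m`.
  have hdisc : (1 - N.lam) * (1 - N.lam - 2 * 1 * N.γ - N.β)
      + (2 - N.lam - 2 * N.β) * N.γ * N.sHat + 2 * 1 * N.β * N.γ - N.chi * N.γ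
      = N.costDen g 1 ^ 2 := by
    simp only [m, a₂, b₂] at hm
    simp only [costDen]
    linear_combination -hm
  rw [w, hdisc, Real.sqrt_sq hA.le, costDen]
  field_simp
  ring

lemma continuous_q_right (N : OpinionGame V) (g : ℝ) : Continuous (N.q g) := by
  unfold q; fun_prop

lemma continuous_m_left (N : OpinionGame V) (h : ℝ) : Continuous fun g => N.m g h := by
  unfold m; fun_prop

end OpinionGame

theorem theorem3 {V : Type*} [Fintype V] [DecidableEq V] [Nonempty V] (N : OpinionGame V)
    (hN : N.Admissible) (hγ : N.γ ≠ 0) :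
    -- the opinions converge to the steady state that enters the cost
    (∀ g ∈ Set.Icc 0 N.sMin, ∀ h ∈ Set.Icc N.sMax 1, ∀ x₀ : V → ℝ,
      (∀ i, x₀ i ∈ Set.Icc (0 : ℝ) 1) →
        Tendsto (fun k : ℕ => (N.step g h)^[k] x₀) atTop (𝓝 (N.steadyState g h))) ∧
    -- the Nash equilibrium
    (0 ≤ N.m 0 1 →
      (0 ≤ N.q 0 1 → N.IsTheNash 0 1) ∧
      (N.q 0 N.sMax ≤ 0 → N.IsTheNash 0 N.sMax) ∧
      (N.q 0 1 < 0 → 0 < N.q 0 N.sMax → N.IsTheNash 0 (N.r 0))) ∧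
    (N.m N.sMin 1 ≤ 0 → N.IsTheNash N.sMin 1) ∧
    (N.m 0 1 < 0 → 0 < N.m N.sMin 1 → N.IsTheNash (N.w 1) 1) ∧
    -- at most one source moves toward the center
    (∀ g h : ℝ, N.IsNash g h → g = 0 ∨ h = 1) := by
  have hone : (1 : ℝ) ∈ Set.Icc N.sMax 1 := ⟨hN.sMax_le_one, le_rfl⟩
  refine ⟨fun g hg h hh x₀ _ => hN.tendsto_iterate_step hγ hg hh x₀,
    fun hm => ⟨fun hq => ?_, fun hq => ?_, fun hq₁ hq₀ => ?_⟩, fun hm => ?_,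
    fun hm₀ hm₁ => ?_, fun g h hn => ?_⟩
  · exact hN.isTheNash_zero hγ hm hone fun h' hh' =>
      mul_nonpos_of_nonpos_of_nonneg (sub_nonpos.2 hh'.2) hq
  · exact hN.isTheNash_zero hγ hm ⟨le_rfl, hN.sMax_le_one⟩ fun h' hh' =>
      mul_nonpos_of_nonneg_of_nonpos (sub_nonneg.2 hh'.1) hq
  -- The intermediate value theorem puts a root inside the strategy interval; the closed form then
  -- identifies it, so feasibility of `r 0` needs no separate estimate.
  · obtain ⟨h₀, hh₀, hroot⟩ := intermediate_value_Icc' hN.sMax_le_one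
      (N.continuous_q_right 0).continuousOn ⟨hq₁.le, hq₀.le⟩
    rw [hN.r_zero_eq hγ hh₀.2 hroot]
    exact hN.isTheNash_zero hγ hm hh₀ fun h' _ => by rw [hroot, mul_zero]
  · have hmono : N.m 0 1 ≤ 0 :=
      (hN.m_monotone hγ hN.sMin_nonneg (by norm_num)).trans hm
    exact hN.isTheNash_one hγ ⟨hN.sMin_nonneg, le_rfl⟩ hmono hm fun g' hg' =>
      mul_nonneg_of_nonpos_of_nonpos (sub_nonpos.2 hg'.2) hm
  · obtain ⟨g₀, hg₀, hroot⟩ := intermediate_value_Icc hN.sMin_nonneg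
      (N.continuous_m_left 1).continuousOn ⟨hm₀.le, hm₁.le⟩
    have hroot' : N.m g₀ 1 = 0 := hroot
    rw [hN.w_one_eq hγ hg₀.1 hroot']
    exact hN.isTheNash_one hγ hg₀ hm₀.le hroot'.le fun g' _ => by rw [hroot', mul_zero]
  · exact (hn.eq_one_or_left_eq_zero hN hγ).symm.imp_left And.left
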